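/- **Setting.** For a chain of $N$ qubits labelled $1,\dots,N$ with Pauli operators $X_i,Z_i$, let the generator $K_i$ be $X_i$ times $Z_l$ for each neighbour $l\in\{i-1,i+1\}\cap\{1,\dots,N\}$. Thus $K_i=Z_{i-1}X_iZ_{i+1}$ for $1<i<N$, and for $N\ge 2$ the boundary generators are $K_1=X_1Z_2$ and $K_N=Z_{N-1}X_N$. A state $\rho$ is a density matrix and $\langle K_i\rangle=\mathrm{Tr}[\rho K_i]$. The concurrence of a two-qubit unit vector is $C(\psi)=|\langle\psi|\,\sigma_y\otimes\sigma_y\,|\psi^*\rangle|$. The concurrence of a two-qubit density matrix $\tau$ is $C(\tau)=\inf\sum_i p_iC(\psi_i)$ over all finite decompositions $\tau=\sum_ip_i|\psi_i\rangle\langle\psi_i|$ into pure states. The localizable entanglement of qubits $j\neq l$ in $\rho$ is $$\mathrm{LE}^{j,l}(\rho)=\sup_{m}\sum_s p_s\,C(\rho^{j,l}_{m,s}),$$ where $m$ runs over all choices of one orthonormal measurement basis for each of the other $N-2$ qubits, $s$ over the strings of outcomes, $p_s$ is the probability of $s$, and $\rho^{j,l}_{m,s}$ is the state of qubits $j,l$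 after outcome $s$ (outcomes with $p_s=0$ contribute $0$). **Theorem.** Let $a$ be a real number (the value denoted $\langle ZXZ\rangle$). 1. Let $\rho$ be a state of $N$ qubits with $\langle K_i\rangle\ge a$ for all $1\le i\le N$. Then for all $k\ge1$ and $1\le j<j+k\le N$, $$\mathrm{LE}^{j,j+k}(\rho)\ \ge\ \max\{0,\;1-(k+1)(1-a)\}.$$ 2. The same bound holds if only $\langle Z_{i-1}X_iZ_{i+1}\rangle\ge a$ for all $1<i<N$ is assumed, provided that $k\ge1$ and $1<j<j+k<N$. 3. For a state $\rho_n$ of a segment of $n\ge2$ qubits all of whose $n$ generators $X_1Z_2,\;Z_{i-1}X_iZ_{i+1}\ (1<i<n),\;Z_{n-1}X_n$ have expectation at least $a$ in $\rho_n$, $$\mathrm{LE}^{1,n}(\rho_n)\ \ge\ \max\{0,\;1-n(1-a)\}.$$ 4. In particular, if $a>2/3$, the localizable entanglement across one measured qubit is nonzero: $\mathrm{LE}^{j,j+2}(\rho)>0$ for all $1\le j\le N-2$ under the hypothesis of part 1, $\mathrm{LE}^{j,j+2}(\rho)>0$ for all $1<j<j+2<N$ under the hypothesis of part 2, and $\mathrm{LE}^{1,3}(\rho_3)>0$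 under the hypothesis of part 3 with $n=3$. -/

import Mathlib

open scoped Kronecker Matrix ComplexOrder

namespace LinearCluster

noncomputable section

/-- Computational basis labels of a register of qubits indexed by `ι`; the Hilbert space of the
register is `Reg ι → ℂ` and its operators are matrices indexed by `Reg ι`. -/
abbrev Reg (ι : Type) : Type := ι → Fin 2

/-- Operators on a register of qubits indexed by `ι`. -/
abbrev Op (ι : Type) : Type := Matrix (Reg ι) (Reg ι) ℂ

/-- Operators on a single qubit. -/
abbrev Op1 : Type := Matrix (Fin 2) (Fin 2) ℂ

/-- Operators on an ordered pair of qubits. -/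
abbrev Op2 : Type := Matrix (Fin 2 × Fin 2) (Fin 2 × Fin 2) ℂ

def pauliX : Op1 := !![0, 1; 1, 0]

def pauliY : Op1 := !![0, -Complex.I; Complex.I, 0]

def pauliZ : Op1 := !![1, 0; 0, -1]

/-- A density matrix: positive semidefinite with unit trace. -/
def IsState {d : Type} [Fintype d] (ρ : Matrix d d ℂ) : Prop :=
  ρ.PosSemidef ∧ ρ.trace = 1

/-- Expectation value `Tr[ρ A]` of the observable `A` in the state `ρ` (a real number for
Hermitian `ρ` and `A`, whence the real part). -/
def expVal {d : Type} [Fintype d] (ρ A : Matrix d d ℂ) : ℝ :=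
  (ρ * A).trace.re

/-- The tensor product `⨂ l, A l` of single-qubit operators. -/
def tensorOp {ι : Type} [Fintype ι] (A : ι → Op1) : Op ι :=
  Matrix.of fun x y => ∏ l, A l (x l) (y l)

/-- The generator centred at qubit `i` of a linear chain of `N` qubits (numbered from `0`): `X` on
qubit `i`, `Z` on each neighbour of `i` in the chain, the identity elsewhere. In the bulk this is
`Z_{i-1} X_i Z_{i+1}`; at the ends of a chain of at least two qubits it is `X_0 Z_1` and
`Z_{N-2} X_{N-1}`. -/
def generator {N : ℕ} (i : Fin N) : Op (Fin N) :=
  tensorOp fun l =>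
    if l = i then pauliX
    else if (l : ℕ) + 1 = i ∨ (l : ℕ) = i + 1 then pauliZ
    else 1

/-- Concurrence of the two-qubit state vector `ψ`: the modulus of the overlap of `ψ` with its spin
flip `(Y ⊗ Y) ψ*`. -/
def pureConcurrence (ψ : Fin 2 × Fin 2 → ℂ) : ℝ :=
  ‖star ψ ⬝ᵥ ((pauliY ⊗ₖ pauliY) *ᵥ star ψ)‖

/-- `c` is the average concurrence of some finite decomposition `ρ = ∑ i, p i |ψ i⟩⟨ψ i|` of `ρ`
into pure states. -/
def IsDecompositionAverage (ρ : Op2) (c : ℝ) : Prop :=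
  ∃ (m : ℕ) (p : Fin m → ℝ) (ψ : Fin m → Fin 2 × Fin 2 → ℂ),
    (∀ i, 0 ≤ p i) ∧ ∑ i, p i = 1 ∧
    (∀ i, star (ψ i) ⬝ᵥ ψ i = 1) ∧
    ρ = ∑ i, (p i : ℂ) • Matrix.vecMulVec (ψ i) (star (ψ i)) ∧
    c = ∑ i, p i * pureConcurrence (ψ i)

/-- Concurrence of a two-qubit density matrix: the smallest average concurrence of a decomposition
into pure states (convex roof). -/
def concurrence (ρ : Op2) : ℝ :=
  sInf {c : ℝ | IsDecompositionAverage ρ c}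

/-- The qubits other than the target qubits `i` and `j`. -/
abbrev Others {ι : Type} (i j : ι) : Type := {l : ι // l ≠ i ∧ l ≠ j}

/-- The basis label with value `a` at `i`, `b` at `j` and `z` on the other qubits. -/
def glue {ι : Type} [DecidableEq ι] {i j : ι} (ab : Fin 2 × Fin 2) (z : Reg (Others i j)) :
    Reg ι :=
  fun l => if hi : l = i then ab.1 else if hj : l = j then ab.2 else z ⟨l, hi, hj⟩

/-- Partial trace over all qubits other than `i` and `j`. -/
def reduceTo {ι : Type} [Fintype ι] [DecidableEq ι] (i j : ι) (M : Op ι) : Op2 :=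
  Matrix.of fun ab cd => ∑ z : Reg (Others i j), M (glue ab z) (glue cd z)

/-- A choice of an orthonormal measurement basis for each qubit other than `i`, `j`; the basis
vectors are the columns of the unitary matrix. -/
abbrev MeasurementBases {ι : Type} (i j : ι) : Type :=
  Others i j → Matrix.unitaryGroup (Fin 2) ℂ

/-- The projector onto the basis vector number `s` (column `s` of `U`). -/
def basisProj (U : Matrix.unitaryGroup (Fin 2) ℂ) (s : Fin 2) : Op1 :=
  Matrix.vecMulVec (fun x => U.1 x s) (star fun x => U.1 x s)

/-- The projector for measuring every qubit other than `i`, `j` in the bases `m` with outcomes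
`s`. -/
def outcomeProj {ι : Type} [Fintype ι] [DecidableEq ι] {i j : ι} (m : MeasurementBases i j)
    (s : Reg (Others i j)) : Op ι :=
  tensorOp fun l => if h : l ≠ i ∧ l ≠ j then basisProj (m ⟨l, h⟩) (s ⟨l, h⟩) else 1

/-- The probability `p_s` of the outcomes `s`. -/
def outcomeProb {ι : Type} [Fintype ι] [DecidableEq ι] {i j : ι} (ρ : Op ι)
    (m : MeasurementBases i j) (s : Reg (Others i j)) : ℝ :=
  expVal ρ (outcomeProj m s)

/-- The state of the qubits `i`, `j` after the measurement in the bases `m` with outcomes `s`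
(meaningful when the outcomes have positive probability). -/
def postState {ι : Type} [Fintype ι] [DecidableEq ι] {i j : ι} (ρ : Op ι)
    (m : MeasurementBases i j) (s : Reg (Others i j)) : Op2 :=
  ((outcomeProb ρ m s)⁻¹ : ℂ) • reduceTo i j (outcomeProj m s * ρ * outcomeProj m s)

/-- The average concurrence of the qubits `i`, `j` after measuring the others in the bases `m`.
Outcomes of probability zero contribute zero. -/
def averageConcurrence {ι : Type} [Fintype ι] [DecidableEq ι] {i j : ι} (ρ : Op ι)
    (m : MeasurementBases i j) : ℝ :=
  ∑ s : Reg (Others i j), outcomeProb ρ m s * concurrence (postState ρ m s)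

/-- Localizable entanglement of the qubits `i ≠ j`, measured by concurrence: the supremum of the
average concurrence over all choices of measurement bases on the other qubits. -/
def localizableEntanglement {ι : Type} [Fintype ι] [DecidableEq ι] (ρ : Op ι) (i j : ι) : ℝ :=
  ⨆ m : MeasurementBases i j, averageConcurrence ρ m

end

end LinearCluster

namespace LinearCluster

/-! ### Concurrence -/

/-! Split the generators centred between the targets `j` and `l = j + k` by parity and multiply each
class. At every site strictly between, the product is `X` or a cancelling `Z * Z`, or trivial;
outside, at most a `Z` survives, next to a target. Measuring `X` inside and `Z` outside therefore
replaces both strings, up to outcome-dependent signs, by a pair of two-qubit Paulis on the targets: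
`XX`, `ZZ` for even `k` and `XZ`, `ZX` for odd `k` (`actsBySigns_stringFactor`,
`bellPair_stringFactor`).

For such a pair `A`, `B` and any signs, `±⟨A⟩ ± ⟨B⟩ - 1` is at most the concurrence of a pure state
(`bell_bound`), and by linearity of the convex roof also of a mixed state. Averaging over outcomes
absorbs the signs and bounds the average concurrence below by the sum of the two string expectations
minus one (`expVal_add_expVal_sub_one_le`). A union bound for commuting involutions costs `1 - a`
per generator (`IsState.one_sub_card_mul_le_expVal`); both classes together have `k + 1` generators.
-/

lemma norm_mul_sub_mul_sq_le (a b c d : ℂ) :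
    2 * ‖a * d - b * c‖ ≤ ‖a‖ ^ 2 + ‖b‖ ^ 2 + ‖c‖ ^ 2 + ‖d‖ ^ 2 := by
  have h := norm_sub_le (a * d) (b * c)
  rw [norm_mul, norm_mul] at h
  nlinarith [sq_nonneg (‖a‖ - ‖d‖), sq_nonneg (‖b‖ - ‖c‖)]

lemma star_dotProduct_self_eq (ψ : Fin 2 × Fin 2 → ℂ) :
    star ψ ⬝ᵥ ψ = ((‖ψ (0, 0)‖ ^ 2 + ‖ψ (0, 1)‖ ^ 2 + ‖ψ (1, 0)‖ ^ 2 + ‖ψ (1, 1)‖ ^ 2 : ℝ) : ℂ) := by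
  simp only [dotProduct, Fintype.sum_prod_type, Fin.sum_univ_two, Pi.star_apply, RCLike.star_def,
    Complex.conj_mul']
  push_cast
  ring

lemma pureConcurrence_eq (ψ : Fin 2 × Fin 2 → ℂ) :
    pureConcurrence ψ = 2 * ‖ψ (0, 0) * ψ (1, 1) - ψ (0, 1) * ψ (1, 0)‖ := by
  have h : star ψ ⬝ᵥ ((pauliY ⊗ₖ pauliY) *ᵥ star ψ)
      = star ((-2) * (ψ (0, 0) * ψ (1, 1) - ψ (0, 1) * ψ (1, 0))) := by
    simp [dotProduct, Matrix.mulVec, Fintype.sum_prod_type, Fin.sum_univ_two, pauliY,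
      Matrix.kroneckerMap_apply]
    ring_nf
  rw [pureConcurrence, h, norm_star, norm_mul]
  simp

lemma pureConcurrence_nonneg (ψ : Fin 2 × Fin 2 → ℂ) : 0 ≤ pureConcurrence ψ := norm_nonneg _

lemma pureConcurrence_le_one {ψ : Fin 2 × Fin 2 → ℂ} (h : star ψ ⬝ᵥ ψ = 1) :
    pureConcurrence ψ ≤ 1 := by
  rw [star_dotProduct_self_eq] at h
  rw [pureConcurrence_eq, ← Complex.ofReal_injective (h.trans Complex.ofReal_one.symm)]
  exact norm_mul_sub_mul_sq_le _ _ _ _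

lemma IsDecompositionAverage.nonneg {τ : Op2} {c : ℝ} (h : IsDecompositionAverage τ c) :
    0 ≤ c := by
  obtain ⟨m, p, ψ, hp, -, -, -, rfl⟩ := h
  exact Finset.sum_nonneg fun i _ => mul_nonneg (hp i) (pureConcurrence_nonneg _)

lemma IsDecompositionAverage.le_one {τ : Op2} {c : ℝ} (h : IsDecompositionAverage τ c) :
    c ≤ 1 := by
  obtain ⟨m, p, ψ, hp, hs, hψ, -, rfl⟩ := h
  rw [← hs]
  exact Finset.sum_le_sum fun i _ => mul_le_of_le_one_right (hp i) (pureConcurrence_le_one (hψ i))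

lemma concurrence_nonneg (τ : Op2) : 0 ≤ concurrence τ :=
  Real.sInf_nonneg fun _ h => h.nonneg

/-- Needed so that the supremum over bases is over a bounded set. A matrix without decompositions is
harmless, since the infimum of the empty set is `0`. -/
lemma concurrence_le_one (τ : Op2) : concurrence τ ≤ 1 := by
  rcases Set.eq_empty_or_nonempty {c : ℝ | IsDecompositionAverage τ c} with h | ⟨c, hc⟩
  · simp [concurrence, h]
  · exact (csInf_le ⟨0, fun _ h => h.nonneg⟩ hc).trans hc.le_one

lemma exists_unit_smul_eq_vecMulVec (v : Fin 2 × Fin 2 → ℂ) :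
    ∃ (p : ℝ) (ψ : Fin 2 × Fin 2 → ℂ), 0 ≤ p ∧ star ψ ⬝ᵥ ψ = 1 ∧
      Matrix.vecMulVec v (star v) = (p : ℂ) • Matrix.vecMulVec ψ (star ψ) := by
  set q : ℝ := ‖v (0, 0)‖ ^ 2 + ‖v (0, 1)‖ ^ 2 + ‖v (1, 0)‖ ^ 2 + ‖v (1, 1)‖ ^ 2 with hq
  have hv : star v ⬝ᵥ v = (q : ℂ) := star_dotProduct_self_eq v
  have hq0 : 0 ≤ q := by positivity
  rcases hq0.eq_or_lt with h0 | hpos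
  -- The zero vector cannot be normalized; any unit vector with weight zero serves.
  · refine ⟨0, Pi.single (0, 0) 1, le_rfl, by simp, ?_⟩
    rw [← h0, Complex.ofReal_zero, dotProduct_star_self_eq_zero] at hv
    simp [hv]
  · have hs : ((Real.sqrt q : ℝ) : ℂ) * (Real.sqrt q : ℝ) = q := by
      rw [← Complex.ofReal_mul, Real.mul_self_sqrt hq0]
    have hsq : ((Real.sqrt q : ℝ) : ℂ) ≠ 0 := by
      simpa using (Real.sqrt_pos.2 hpos).ne'
    have hst : star (((Real.sqrt q : ℝ) : ℂ)⁻¹) = ((Real.sqrt q : ℝ) : ℂ)⁻¹ := by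
      simp
    refine ⟨q, ((Real.sqrt q : ℝ) : ℂ)⁻¹ • v, hq0, ?_, ?_⟩
    · rw [star_smul, smul_dotProduct, dotProduct_smul, hv, hst, ← hs]
      simp only [smul_eq_mul]
      field_simp
    · rw [star_smul, hst, Matrix.smul_vecMulVec, Matrix.vecMulVec_smul, smul_smul, smul_smul,
        ← hs]
      field_simp
      simp

lemma trace_vecMulVec_star (ψ : Fin 2 × Fin 2 → ℂ) (A : Op2) :
    (Matrix.vecMulVec ψ (star ψ) * A).trace = star ψ ⬝ᵥ (A *ᵥ ψ) := by
  rw [Matrix.vecMulVec_mul, Matrix.trace_vecMulVec, dotProduct_comm, Matrix.dotProduct_mulVec]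

/-- A lower bound on an infimum needs a nonempty set; a Gram decomposition of the positive matrix,
normalized term by term, supplies an element. -/
lemma IsState.exists_isDecompositionAverage {τ : Op2} (h : IsState τ) :
    ∃ c, IsDecompositionAverage τ c := by
  obtain ⟨m, v, hv⟩ := Matrix.posSemidef_iff_eq_sum_vecMulVec.1 h.1
  choose p ψ hp hψ hpψ using fun i => exists_unit_smul_eq_vecMulVec (v i)
  simp only [hpψ] at hv
  refine ⟨_, m, p, ψ, hp, ?_, hψ, hv, rfl⟩
  have ht := h.2
  simp only [hv, Matrix.trace_sum, Matrix.trace_smul, Matrix.trace_vecMulVec,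
    dotProduct_comm (ψ _), hψ, smul_eq_mul, mul_one] at ht
  exact_mod_cast ht

/-- An operator whose expectation, minus one, is below the concurrence on unit vectors yields
a lower bound on the concurrence of density matrices. -/
lemma IsState.le_concurrence {τ : Op2} (h : IsState τ) {W : Op2}
    (hW : ∀ ψ, star ψ ⬝ᵥ ψ = 1 → (star ψ ⬝ᵥ (W *ᵥ ψ)).re - 1 ≤ pureConcurrence ψ) :
    expVal τ W - 1 ≤ concurrence τ := by
  refine le_csInf h.exists_isDecompositionAverage ?_
  rintro c ⟨m, p, ψ, hp, hs, hψ, hτ, rfl⟩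
  have hE : expVal τ W = ∑ i, p i * (star (ψ i) ⬝ᵥ (W *ᵥ ψ i)).re := by
    rw [expVal, hτ, Finset.sum_mul, Matrix.trace_sum, Complex.re_sum]
    refine Finset.sum_congr rfl fun i _ => ?_
    rw [Matrix.smul_mul, Matrix.trace_smul, trace_vecMulVec_star, smul_eq_mul,
      Complex.re_ofReal_mul]
  rw [hE, ← hs, ← Finset.sum_sub_distrib]
  refine Finset.sum_le_sum fun i _ => ?_
  have := mul_le_mul_of_nonneg_left (hW _ (hψ i)) (hp i)
  linarith

/-- The same bound for unnormalized states. -/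
lemma le_trace_mul_concurrence {M : Op2} (hM : M.PosSemidef) {p : ℝ} (hp : M.trace = p) {W : Op2}
    (hW : ∀ ψ, star ψ ⬝ᵥ ψ = 1 → (star ψ ⬝ᵥ (W *ᵥ ψ)).re - 1 ≤ pureConcurrence ψ) :
    expVal M W - p ≤ p * concurrence ((p⁻¹ : ℂ) • M) := by
  have hp0 : 0 ≤ p := by
    have := hM.trace_nonneg
    rw [hp] at this
    exact_mod_cast this
  rcases hp0.eq_or_lt with h0 | hpos
  -- A positive matrix of trace zero vanishes, so outcomes of probability zero contribute nothing to
  -- either side.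
  · have : M = 0 := hM.trace_eq_zero_iff.1 (by rw [hp, ← h0]; simp)
    simp [this, expVal, ← h0]
  · have hne : (p : ℂ) ≠ 0 := by exact_mod_cast hpos.ne'
    have hinv : (0 : ℂ) ≤ (p : ℂ)⁻¹ := by
      rw [← Complex.ofReal_inv]
      exact_mod_cast inv_nonneg.2 hp0
    have hst : IsState ((p⁻¹ : ℂ) • M) :=
      ⟨hM.smul hinv, by rw [Matrix.trace_smul, hp, smul_eq_mul, inv_mul_cancel₀ hne]⟩
    have h := mul_le_mul_of_nonneg_left (hst.le_concurrence hW) hp0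
    have hE : expVal ((p⁻¹ : ℂ) • M) W = p⁻¹ * expVal M W := by
      rw [expVal, Matrix.smul_mul, Matrix.trace_smul, smul_eq_mul, ← Complex.ofReal_inv,
        Complex.re_ofReal_mul, expVal]
    rw [hE, mul_sub, ← mul_assoc, mul_inv_cancel₀ hpos.ne'] at h
    linarith

/-! ### Pauli pairs that witness concurrence -/

lemma re_conj_mul_le (a b : ℂ) {t : ℝ} (ht : t = 1 ∨ t = -1) :
    t * (star a * b).re ≤ ‖a‖ * ‖b‖ := by
  have h := Complex.abs_re_le_norm (star a * b)
  rw [norm_mul, norm_star, abs_le] at h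
  rcases ht with rfl | rfl <;> linarith

/-- For `s = 1` the terms `‖a‖ ^ 2` and `‖d‖ ^ 2` cancel, and completing the square in `‖b‖ - ‖c‖`
leaves at most `2 * (‖a * d‖ - ‖b * c‖)`. The case `s = -1` exchanges the two pairs. -/
lemma bell_bound (a b c d : ℂ) {s t : ℝ} (hs : s = 1 ∨ s = -1) (ht : t = 1 ∨ t = -1) :
    s * (‖a‖ ^ 2 - ‖b‖ ^ 2 - ‖c‖ ^ 2 + ‖d‖ ^ 2)
        + t * (2 * (star a * d).re + 2 * (star b * c).re)
        - (‖a‖ ^ 2 + ‖b‖ ^ 2 + ‖c‖ ^ 2 + ‖d‖ ^ 2) ≤ 2 * ‖a * d - b * c‖ := by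
  have h1 := re_conj_mul_le a d ht
  have h2 := re_conj_mul_le b c ht
  have h3 := norm_sub_norm_le (a * d) (b * c)
  have h4 := norm_sub_norm_le (b * c) (a * d)
  rw [norm_sub_rev (b * c)] at h4
  rw [norm_mul, norm_mul] at h3 h4
  rcases hs with rfl | rfl
  · nlinarith [sq_nonneg (‖b‖ - ‖c‖)]
  · nlinarith [sq_nonneg (‖a‖ - ‖d‖)]

/-- On unit vectors, `s ⟨A⟩ + t ⟨B⟩ - 1` is at most the concurrence, for all signs `s`, `t`. -/
def BellPair (A B : Op2) : Prop :=
  ∀ s t : ℝ, (s = 1 ∨ s = -1) → (t = 1 ∨ t = -1) → ∀ ψ, star ψ ⬝ᵥ ψ = 1 →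
    (star ψ ⬝ᵥ (((s : ℂ) • A + (t : ℂ) • B) *ᵥ ψ)).re - 1 ≤ pureConcurrence ψ

lemma bellPair_ZZ_XX : BellPair (pauliZ ⊗ₖ pauliZ) (pauliX ⊗ₖ pauliX) := by
  intro s t hs ht ψ hψ
  have h := bell_bound (ψ (0, 0)) (ψ (0, 1)) (ψ (1, 0)) (ψ (1, 1)) hs ht
  rw [star_dotProduct_self_eq] at hψ
  rw [pureConcurrence_eq]
  rw [Complex.ofReal_injective (hψ.trans Complex.ofReal_one.symm)] at h
  convert h using 2
  simp [dotProduct, Matrix.mulVec, Fintype.sum_prod_type, Fin.sum_univ_two, pauliZ, pauliX,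
      Matrix.kroneckerMap_apply, Complex.sq_norm, Complex.normSq_apply]
  ring

lemma bellPair_XZ_ZX : BellPair (pauliX ⊗ₖ pauliZ) (pauliZ ⊗ₖ pauliX) := by
  intro s t hs ht ψ hψ
  set a := ψ (0, 0) with ha
  set b := ψ (0, 1) with hb
  set c := ψ (1, 0) with hc
  set d := ψ (1, 1) with hd
  -- An unnormalized Hadamard on the second qubit turns `XZ`, `ZX` into `XX`, `ZZ`; hence the
  -- swapped signs, and a common factor `2` on both sides.
  have h := bell_bound (a + b) (a - b) (c + d) (c - d) ht hs
  have e : (a + b) * (c - d) - (a - b) * (c + d) = (-2) * (a * d - b * c) := by ring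
  rw [e, norm_mul, norm_neg, Complex.norm_ofNat] at h
  rw [star_dotProduct_self_eq] at hψ
  have h1 := Complex.ofReal_injective (hψ.trans Complex.ofReal_one.symm)
  rw [pureConcurrence_eq]
  have h2 : (star ψ ⬝ᵥ (((s : ℂ) • (pauliX ⊗ₖ pauliZ) + (t : ℂ) • (pauliZ ⊗ₖ pauliX)) *ᵥ ψ)).re
      = s * (2 * (star a * c).re - 2 * (star b * d).re)
        + t * (2 * (star a * b).re - 2 * (star c * d).re) := by
    simp [dotProduct, Matrix.mulVec, Fintype.sum_prod_type, Fin.sum_univ_two, pauliZ, pauliX,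
      Matrix.kroneckerMap_apply, ← ha, ← hb, ← hc, ← hd]
    ring
  rw [h2]
  rw [← ha, ← hb, ← hc, ← hd] at h1 ⊢
  simp only [Complex.sq_norm, Complex.normSq_apply, Complex.add_re, Complex.add_im, Complex.sub_re,
    Complex.sub_im, RCLike.star_def, Complex.mul_re, Complex.conj_re, Complex.conj_im] at h h1 ⊢
  linarith

lemma BellPair.symm {A B : Op2} (h : BellPair A B) : BellPair B A := fun s t hs ht ψ hψ => by
  rw [add_comm]
  exact h t s ht hs ψ hψ

end LinearCluster

namespace LinearCluster

/-! ### Tensor products of single-qubit operators -/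

lemma tensorOp_apply {ι : Type} [Fintype ι] (A : ι → Op1) (x y : Reg ι) :
    tensorOp A x y = ∏ l, A l (x l) (y l) := rfl

lemma tensorOp_conjTranspose {ι : Type} [Fintype ι] (A : ι → Op1) :
    (tensorOp A)ᴴ = tensorOp fun l => (A l)ᴴ := by
  ext x y
  simp [Matrix.conjTranspose_apply, tensorOp_apply]

lemma tensorOp_isHermitian {ι : Type} [Fintype ι] {A : ι → Op1} (h : ∀ l, (A l).IsHermitian) :
    (tensorOp A).IsHermitian := by
  rw [Matrix.IsHermitian, tensorOp_conjTranspose]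
  exact congrArg _ (funext h)

lemma expVal_smul {d : Type} [Fintype d] (ρ A : Matrix d d ℂ) (c : ℝ) :
    expVal ρ ((c : ℂ) • A) = c * expVal ρ A := by
  rw [expVal, Matrix.mul_smul, Matrix.trace_smul, smul_eq_mul, Complex.re_ofReal_mul, expVal]

lemma expVal_add {d : Type} [Fintype d] (ρ A B : Matrix d d ℂ) :
    expVal ρ (A + B) = expVal ρ A + expVal ρ B := by
  rw [expVal, mul_add, Matrix.trace_add, Complex.add_re, expVal, expVal]

lemma tensorOp_one {ι : Type} [Fintype ι] : tensorOp (fun _ : ι => (1 : Op1)) = 1 := by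
  ext x y
  rw [tensorOp_apply, Matrix.one_apply]
  split_ifs with h
  · subst h
    exact Finset.prod_eq_one fun l _ => Matrix.one_apply_eq _
  · obtain ⟨l, hl⟩ := Function.ne_iff.1 h
    exact Finset.prod_eq_zero (Finset.mem_univ l) (Matrix.one_apply_ne hl)

lemma glue_left {ι : Type} [DecidableEq ι] {i j : ι} (ab : Fin 2 × Fin 2) (z : Reg (Others i j)) :
    glue ab z i = ab.1 := by
  simp [glue]

lemma glue_right {ι : Type} [DecidableEq ι] {i j : ι} (hij : i ≠ j) (ab : Fin 2 × Fin 2)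
    (z : Reg (Others i j)) :
    glue ab z j = ab.2 := by
  simp [glue, hij.symm]

lemma glue_others {ι : Type} [DecidableEq ι] {i j : ι} (ab : Fin 2 × Fin 2)
    (z : Reg (Others i j)) (l : Others i j) :
    glue ab z l = z l := by
  simp [glue, l.2.1, l.2.2]

section Tensor

variable {ι : Type} [Fintype ι] [DecidableEq ι]

lemma tensorOp_mul (A B : ι → Op1) : tensorOp A * tensorOp B = tensorOp fun l => A l * B l := by
  ext x y
  simp only [Matrix.mul_apply, tensorOp_apply, ← Finset.prod_mul_distrib]
  exact (Fintype.prod_sum fun l k => A l (x l) k * B l k (y l)).symm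

/-- Splitting off the factors at two distinct sites. -/
lemma prod_eq_mul_mul_prod_others {M : Type*} [CommMonoid M] {i j : ι} (hij : i ≠ j) (f : ι → M) :
    ∏ l, f l = f i * f j * ∏ l : Others i j, f l := by
  rw [← Finset.mul_prod_erase _ _ (Finset.mem_univ i),
    ← Finset.mul_prod_erase _ _ (Finset.mem_erase.2 ⟨hij.symm, Finset.mem_univ j⟩), mul_assoc]
  congr 2
  refine Finset.prod_subtype _ (fun l => ?_) f
  simp [and_comm]

/-- Labels of a register, split into the labels of two distinct sites and the others. -/
def glueEquiv {i j : ι} (hij : i ≠ j) : (Fin 2 × Fin 2) × Reg (Others i j) ≃ Reg ι where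
  toFun q := glue q.1 q.2
  invFun x := ((x i, x j), fun l => x l)
  left_inv q := by
    refine Prod.ext (Prod.ext ?_ ?_) (funext fun l => ?_)
    · simp [glue]
    · simp [glue, hij.symm]
    · simp [glue, l.2.1, l.2.2]
  right_inv x := by
    funext l
    by_cases hi : l = i
    · simp [glue, hi]
    · by_cases hj : l = j
      · subst hj; simp [glue, hi]
      · simp [glue, hi, hj]

/-- The operator `a` at `i`, `b` at `j` and the identity elsewhere. -/
def liftOp (i j : ι) (a b : Op1) : Op ι :=
  tensorOp fun l => if l = i then a else if l = j then b else 1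

lemma liftOp_glue {i j : ι} (hij : i ≠ j) (a b : Op1) (ab cd : Fin 2 × Fin 2)
    (z w : Reg (Others i j)) :
    liftOp i j a b (glue ab z) (glue cd w) = if z = w then (a ⊗ₖ b) ab cd else 0 := by
  have h1 : ∀ l : Others i j, ((if (l : ι) = i then a else if (l : ι) = j then b else 1 : Op1)
      (z l) (w l)) = (1 : Op1) (z l) (w l) := fun l => by
    rw [if_neg l.2.1, if_neg l.2.2]
  have h2 : ∏ l, (1 : Op1) (z l) (w l) = (1 : Op (Others i j)) z w := by
    rw [← tensorOp_one, tensorOp_apply]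
  rw [liftOp, tensorOp_apply, prod_eq_mul_mul_prod_others hij]
  simp only [glue_left, glue_right hij, glue_others, if_true, if_neg hij.symm, h1]
  rw [h2, Matrix.one_apply]
  split_ifs <;> simp [Matrix.kroneckerMap_apply]

/-- The partial trace is adjoint to padding with identities: those force the labels off the targets
to agree. -/
lemma trace_reduceTo_mul {i j : ι} (hij : i ≠ j) (M : Op ι) (a b : Op1) :
    (reduceTo i j M * (a ⊗ₖ b)).trace = (M * liftOp i j a b).trace := by
  have h : (M * liftOp i j a b).trace = ∑ ab, ∑ z : Reg (Others i j), ∑ cd,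
      ∑ w : Reg (Others i j), M (glue ab z) (glue cd w) *
        liftOp i j a b (glue cd w) (glue ab z) := by
    simp only [Matrix.trace, Matrix.diag, Matrix.mul_apply]
    rw [← (glueEquiv hij).sum_comp, Fintype.sum_prod_type]
    refine Finset.sum_congr rfl fun ab _ => Finset.sum_congr rfl fun z _ => ?_
    rw [← (glueEquiv hij).sum_comp, Fintype.sum_prod_type]
    rfl
  rw [h]
  simp only [Matrix.trace, Matrix.diag, Matrix.mul_apply]
  refine Finset.sum_congr rfl fun ab _ => ?_
  simp only [liftOp_glue hij, mul_ite, mul_zero, Finset.sum_ite_eq', Finset.mem_univ, if_true,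
    reduceTo, Matrix.of_apply, Finset.sum_mul]
  exact Finset.sum_comm

lemma liftOp_one (i j : ι) : liftOp i j 1 1 = 1 := by
  simp [liftOp, tensorOp_one]

lemma trace_reduceTo {i j : ι} (hij : i ≠ j) (M : Op ι) : (reduceTo i j M).trace = M.trace := by
  have h := trace_reduceTo_mul hij M 1 1
  rwa [liftOp_one, Matrix.one_kronecker_one, mul_one, mul_one] at h

lemma posSemidef_reduceTo (i j : ι) {M : Op ι} (hM : M.PosSemidef) :
    (reduceTo i j M).PosSemidef := by
  have h : reduceTo i j M
      = ∑ z : Reg (Others i j), M.submatrix (fun ab => glue ab z) (fun ab => glue ab z) := by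
    ext ab cd
    simp [reduceTo, Matrix.sum_apply]
  rw [h]
  exact Matrix.posSemidef_sum _ fun z _ => hM.submatrix _

/-! ### Local projective measurements -/

lemma basisProj_isHermitian (U : Matrix.unitaryGroup (Fin 2) ℂ) (s : Fin 2) :
    (basisProj U s).IsHermitian := by
  ext x y
  simp [basisProj, Matrix.vecMulVec_apply, mul_comm]

lemma basisProj_mul_self (U : Matrix.unitaryGroup (Fin 2) ℂ) (s : Fin 2) :
    basisProj U s * basisProj U s = basisProj U s := by
  have h : star (fun x => U.1 x s) ⬝ᵥ (fun x => U.1 x s) = 1 := by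
    have := congrFun (congrFun (Matrix.mem_unitaryGroup_iff'.1 U.2) s) s
    simpa [Matrix.mul_apply, dotProduct, Matrix.star_apply] using this
  rw [basisProj, Matrix.vecMulVec_mul_vecMulVec, h]
  simp

lemma sum_basisProj (U : Matrix.unitaryGroup (Fin 2) ℂ) : ∑ s, basisProj U s = 1 := by
  rw [← Matrix.mem_unitaryGroup_iff.1 U.2]
  ext x y
  simp [basisProj, Matrix.vecMulVec_apply, Matrix.mul_apply, Matrix.sum_apply]

variable {i j : ι}

lemma outcomeProj_isHermitian (m : MeasurementBases i j) (s : Reg (Others i j)) :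
    (outcomeProj m s).IsHermitian := by
  refine tensorOp_isHermitian fun l => ?_
  split_ifs
  · exact basisProj_isHermitian _ _
  · exact Matrix.isHermitian_one

lemma outcomeProj_mul_self (m : MeasurementBases i j) (s : Reg (Others i j)) :
    outcomeProj m s * outcomeProj m s = outcomeProj m s := by
  rw [outcomeProj, tensorOp_mul]
  congr 1
  funext l
  split_ifs
  · exact basisProj_mul_self _ _
  · exact mul_one _

/-- By distributivity, the sum over outcome strings is a product over sites of single-qubit
resolutions of the identity. -/
lemma sum_outcomeProj (hij : i ≠ j) (m : MeasurementBases i j) : ∑ s, outcomeProj m s = 1 := by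
  rw [← tensorOp_one]
  ext x y
  have h1 : ∀ s : Reg (Others i j), outcomeProj m s x y =
      (1 : Op1) (x i) (y i) * (1 : Op1) (x j) (y j) *
        ∏ l : Others i j, basisProj (m l) (s l) (x l) (y l) := fun s => by
    rw [outcomeProj, tensorOp_apply, prod_eq_mul_mul_prod_others hij]
    simp only [ne_eq, not_true_eq_false, false_and, and_false, dite_false]
    congr 1
    exact Finset.prod_congr rfl fun l _ => by rw [dif_pos l.2]
  rw [Matrix.sum_apply, Finset.sum_congr rfl fun s _ => h1 s, ← Finset.mul_sum,
    ← Fintype.prod_sum fun (l : Others i j) k => basisProj (m l) k (x l) (y l),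
    tensorOp_apply, prod_eq_mul_mul_prod_others hij]
  congr 1
  refine Finset.prod_congr rfl fun l _ => ?_
  rw [← sum_basisProj (m l), Matrix.sum_apply]

lemma sum_expVal_mul_outcomeProj (hij : i ≠ j) (m : MeasurementBases i j) (ρ A : Op ι) :
    ∑ s, expVal ρ (A * outcomeProj m s) = expVal ρ A := by
  simp only [expVal]
  rw [← Complex.re_sum, ← Matrix.trace_sum, ← Finset.mul_sum, ← Finset.mul_sum,
    sum_outcomeProj hij, mul_one]

/-- The unnormalized state of the target qubits after the outcomes `s`. -/
lemma posSemidef_reduceTo_outcome {ρ : Op ι} (hρ : ρ.PosSemidef) (m : MeasurementBases i j)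
    (s : Reg (Others i j)) :
    (reduceTo i j (outcomeProj m s * ρ * outcomeProj m s)).PosSemidef := by
  have h := hρ.mul_mul_conjTranspose_same (outcomeProj m s)
  rw [(outcomeProj_isHermitian m s).eq] at h
  exact posSemidef_reduceTo i j h

lemma trace_reduceTo_outcome (hij : i ≠ j) {ρ : Op ι} (hρ : ρ.PosSemidef)
    (m : MeasurementBases i j) (s : Reg (Others i j)) :
    (reduceTo i j (outcomeProj m s * ρ * outcomeProj m s)).trace = (outcomeProb ρ m s : ℂ) := by
  have h0 := (posSemidef_reduceTo_outcome hρ m s).trace_nonneg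
  have h : (reduceTo i j (outcomeProj m s * ρ * outcomeProj m s)).trace
      = (ρ * outcomeProj m s).trace := by
    rw [trace_reduceTo hij, mul_assoc, Matrix.trace_mul_comm, mul_assoc, outcomeProj_mul_self]
  rw [h] at h0 ⊢
  -- Positivity makes the trace real, so taking the real part in `expVal` loses nothing.
  exact Complex.ext rfl (by simpa using (Complex.nonneg_iff.1 h0).2.symm)

lemma outcomeProb_nonneg (hij : i ≠ j) {ρ : Op ι} (hρ : ρ.PosSemidef)
    (m : MeasurementBases i j) (s : Reg (Others i j)) : 0 ≤ outcomeProb ρ m s := by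
  have h := (posSemidef_reduceTo_outcome hρ m s).trace_nonneg
  rw [trace_reduceTo_outcome hij hρ] at h
  exact_mod_cast h

lemma sum_outcomeProb (hij : i ≠ j) {ρ : Op ι} (hρ : IsState ρ) (m : MeasurementBases i j) :
    ∑ s, outcomeProb ρ m s = 1 := by
  have h := sum_expVal_mul_outcomeProj hij m ρ 1
  simp only [one_mul] at h
  simp only [outcomeProb, h]
  rw [expVal, mul_one, hρ.2, Complex.one_re]

lemma averageConcurrence_nonneg (hij : i ≠ j) {ρ : Op ι} (hρ : IsState ρ)
    (m : MeasurementBases i j) : 0 ≤ averageConcurrence ρ m :=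
  Finset.sum_nonneg fun s _ =>
    mul_nonneg (outcomeProb_nonneg hij hρ.1 m s) (concurrence_nonneg _)

lemma averageConcurrence_le_one (hij : i ≠ j) {ρ : Op ι} (hρ : IsState ρ)
    (m : MeasurementBases i j) : averageConcurrence ρ m ≤ 1 := by
  rw [← sum_outcomeProb hij hρ m]
  exact Finset.sum_le_sum fun s _ =>
    mul_le_of_le_one_right (outcomeProb_nonneg hij hρ.1 m s) (concurrence_le_one _)

lemma averageConcurrence_le_localizableEntanglement (hij : i ≠ j) {ρ : Op ι} (hρ : IsState ρ)
    (m : MeasurementBases i j) : averageConcurrence ρ m ≤ localizableEntanglement ρ i j :=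
  le_ciSup (f := fun m : MeasurementBases i j => averageConcurrence ρ m)
    ⟨1, by rintro _ ⟨m, rfl⟩; exact averageConcurrence_le_one hij hρ m⟩ m

lemma localizableEntanglement_nonneg (hij : i ≠ j) {ρ : Op ι} (hρ : IsState ρ) :
    0 ≤ localizableEntanglement ρ i j :=
  (averageConcurrence_nonneg hij hρ 1).trans
    (averageConcurrence_le_localizableEntanglement hij hρ 1)

/-! ### Pauli strings restricted to a measurement outcome -/

/-- `F` acts on the basis `U` by signs. -/
def ActsBySigns (F : Op1) (U : Matrix.unitaryGroup (Fin 2) ℂ) : Prop :=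
  ∃ ε : Fin 2 → ℝ, (∀ s, ε s = 1 ∨ ε s = -1) ∧ ∀ s, F * basisProj U s = (ε s : ℂ) • basisProj U s

lemma prod_sign {κ : Type} [Fintype κ] {f : κ → ℝ} (h : ∀ l, f l = 1 ∨ f l = -1) :
    ∏ l, f l = 1 ∨ ∏ l, f l = -1 := by
  rw [← sq_eq_one_iff, ← Finset.prod_pow]
  exact Finset.prod_eq_one fun l _ => by rcases h l with h | h <;> simp [h]

lemma exists_sign_liftOp (hij : i ≠ j) {F : ι → Op1} {m : MeasurementBases i j}
    (hF : ∀ l : Others i j, ActsBySigns (F l) (m l)) (s : Reg (Others i j)) :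
    ∃ σ : ℝ, (σ = 1 ∨ σ = -1) ∧
      tensorOp F * outcomeProj m s = (σ : ℂ) • (liftOp i j (F i) (F j) * outcomeProj m s) := by
  choose ε hε hF using hF
  refine ⟨∏ l, ε l (s l), prod_sign fun l => hε l (s l), ?_⟩
  ext x y
  rw [outcomeProj, liftOp, tensorOp_mul, tensorOp_mul, Matrix.smul_apply, tensorOp_apply,
    tensorOp_apply, prod_eq_mul_mul_prod_others hij,
    prod_eq_mul_mul_prod_others hij (fun l => ((if l = i then F i else if l = j then F j else 1) *
      (if h : l ≠ i ∧ l ≠ j then basisProj (m ⟨l, h⟩) (s ⟨l, h⟩) else 1) : Op1) (x l) (y l))]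
  simp only [ne_eq, not_true_eq_false, false_and, and_false, dite_false, if_true, if_neg hij.symm]
  rw [Complex.ofReal_prod, smul_eq_mul, mul_left_comm, ← Finset.prod_mul_distrib]
  congr 1
  refine Finset.prod_congr rfl fun l _ => ?_
  rw [dif_pos l.2, if_neg l.2.1, if_neg l.2.2, one_mul]
  exact congrFun (congrFun (hF l (s l)) (x l)) (y l)

lemma liftOp_commute_outcomeProj (a b : Op1) (m : MeasurementBases i j) (s : Reg (Others i j)) :
    liftOp i j a b * outcomeProj m s = outcomeProj m s * liftOp i j a b := by
  rw [outcomeProj, liftOp, tensorOp_mul, tensorOp_mul]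
  congr 1
  funext l
  by_cases h : l ≠ i ∧ l ≠ j
  · rw [dif_pos h, if_neg h.1, if_neg h.2, one_mul, mul_one]
  · rw [dif_neg h, one_mul, mul_one]

lemma expVal_reduceTo_outcome (hij : i ≠ j) (ρ : Op ι) (a b : Op1) (m : MeasurementBases i j)
    (s : Reg (Others i j)) :
    expVal (reduceTo i j (outcomeProj m s * ρ * outcomeProj m s)) (a ⊗ₖ b)
      = expVal ρ (liftOp i j a b * outcomeProj m s) := by
  rw [expVal, expVal, trace_reduceTo_mul hij, mul_assoc, mul_assoc, Matrix.trace_mul_comm,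
    ← liftOp_commute_outcomeProj, mul_assoc, mul_assoc, outcomeProj_mul_self]

/-- Two strings that act by signs on the measured qubits and restrict to a Bell pair on the target
qubits bound the average concurrence from below. -/
lemma expVal_add_expVal_sub_one_le (hij : i ≠ j) {ρ : Op ι} (hρ : IsState ρ)
    {m : MeasurementBases i j} {F G : ι → Op1} (hF : ∀ l : Others i j, ActsBySigns (F l) (m l))
    (hG : ∀ l : Others i j, ActsBySigns (G l) (m l))
    (hFG : BellPair (F i ⊗ₖ F j) (G i ⊗ₖ G j)) :
    expVal ρ (tensorOp F) + expVal ρ (tensorOp G) - 1 ≤ averageConcurrence ρ m := by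
  rw [← sum_expVal_mul_outcomeProj hij m ρ (tensorOp F),
    ← sum_expVal_mul_outcomeProj hij m ρ (tensorOp G), ← sum_outcomeProb hij hρ m,
    ← Finset.sum_add_distrib, ← Finset.sum_sub_distrib]
  refine Finset.sum_le_sum fun s _ => ?_
  obtain ⟨σ, hσ, hFσ⟩ := exists_sign_liftOp hij hF s
  obtain ⟨τ, hτ, hGτ⟩ := exists_sign_liftOp hij hG s
  rw [hFσ, hGτ, expVal_smul, expVal_smul, ← expVal_reduceTo_outcome hij,
    ← expVal_reduceTo_outcome hij, ← expVal_smul, ← expVal_smul, ← expVal_add]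
  exact le_trace_mul_concurrence (posSemidef_reduceTo_outcome hρ.1 m s)
    (trace_reduceTo_outcome hij hρ.1 m s) (hFG σ τ hσ hτ)

end Tensor

end LinearCluster

namespace LinearCluster

/-! ### Products of generators -/

lemma IsState.expVal_one {d : Type} [Fintype d] [DecidableEq d] {ρ : Matrix d d ℂ}
    (hρ : IsState ρ) : expVal ρ 1 = 1 := by
  rw [expVal, mul_one, hρ.2, Complex.one_re]

/-- For commuting Hermitian involutions `A`, `B`, one has `A * B ≥ A + B - 1`. -/
lemma IsState.expVal_add_expVal_sub_one_le_expVal_mul {d : Type} [Fintype d] [DecidableEq d]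
    {ρ A B : Matrix d d ℂ} (hρ : IsState ρ) (hA : A.IsHermitian) (hB : B.IsHermitian)
    (hAB : (A * B).IsHermitian) (hA1 : A * A = 1) (hB1 : B * B = 1) :
    expVal ρ A + expVal ρ B - 1 ≤ expVal ρ (A * B) := by
  have hcomm : B * A = A * B := by
    rw [← hAB.eq, Matrix.conjTranspose_mul, hA.eq, hB.eq]
  -- `Q` is four times the projector onto the joint `-1` eigenspace, so its expectation is
  -- nonnegative; expanding the product gives the claim.
  set Q : Matrix d d ℂ := (1 - A) * (1 - B) with hQd
  have hsq : Qᴴ * Q = ((4 : ℝ) : ℂ) • Q := by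
    have hh : Qᴴ = Q := by
      rw [hQd, Matrix.conjTranspose_mul, Matrix.conjTranspose_sub, Matrix.conjTranspose_sub,
        Matrix.conjTranspose_one, hA.eq, hB.eq]
      noncomm_ring
      rw [hcomm]
    have hA2 : (1 - A) * (1 - A) = (2 : ℂ) • (1 - A) := by
      rw [sub_mul, mul_sub, mul_sub, hA1, two_smul]
      noncomm_ring
    have hB2 : (1 - B) * (1 - B) = (2 : ℂ) • (1 - B) := by
      rw [sub_mul, mul_sub, mul_sub, hB1, two_smul]
      noncomm_ring
    have hc : (1 - B) * (1 - A) = (1 - A) * (1 - B) := by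
      noncomm_ring
      rw [hcomm]
    rw [hh, hQd, mul_assoc, ← mul_assoc (1 - B), hc, mul_assoc, ← mul_assoc, hA2, hB2,
      Matrix.smul_mul, Matrix.mul_smul, smul_smul]
    norm_num
  have hpos : 0 ≤ 4 * expVal ρ Q := by
    have h := (hρ.1.mul_mul_conjTranspose_same Q).trace_nonneg
    rw [mul_assoc, Matrix.trace_mul_comm, mul_assoc, hsq] at h
    rw [← expVal_smul]
    exact (Complex.nonneg_iff.1 h).1
  have hQe : Q + A + B = 1 + A * B := by
    rw [hQd]
    noncomm_ring
  have h5 := congrArg (expVal ρ) hQe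
  rw [expVal_add, expVal_add, expVal_add, hρ.expVal_one] at h5
  linarith

lemma pauliX_isHermitian : pauliX.IsHermitian := by
  ext x y; fin_cases x <;> fin_cases y <;> simp [pauliX]

lemma pauliZ_isHermitian : pauliZ.IsHermitian := by
  ext x y; fin_cases x <;> fin_cases y <;> simp [pauliZ]

lemma pauliX_mul_self : pauliX * pauliX = 1 := by
  ext x y; fin_cases x <;> fin_cases y <;> simp [pauliX]

lemma pauliZ_mul_self : pauliZ * pauliZ = 1 := by
  ext x y; fin_cases x <;> fin_cases y <;> simp [pauliZ]

open Classical in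
/-- The factor at site `l` of the product of the generators centred in `E`, where `E` contains no
two neighbours. -/
noncomputable def stringFactor (E : Finset ℕ) (l : ℕ) : Op1 :=
  if l ∈ E then pauliX
  else (if l + 1 ∈ E then pauliZ else 1) * (if ∃ e ∈ E, l = e + 1 then pauliZ else 1)

lemma stringFactor_empty (l : ℕ) : stringFactor ∅ l = 1 := by
  simp [stringFactor]

lemma stringFactor_mul_self (E : Finset ℕ) (l : ℕ) :
    stringFactor E l * stringFactor E l = 1 := by
  unfold stringFactor
  split_ifs <;> simp [pauliX_mul_self, pauliZ_mul_self]

lemma stringFactor_isHermitian (E : Finset ℕ) (l : ℕ) : (stringFactor E l).IsHermitian := by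
  unfold stringFactor
  split_ifs <;> simp [pauliX_isHermitian, pauliZ_isHermitian, pauliZ_mul_self]

/-- The ends of the chain need no separate case: a neighbour outside it is never a value of `l`. -/
lemma stringFactor_singleton {N : ℕ} (i : Fin N) :
    tensorOp (fun l : Fin N => stringFactor {(i : ℕ)} l) = generator i := by
  rw [generator]
  congr 1
  funext l
  by_cases h : l = i
  · simp [stringFactor, h]
  · have h' : (l : ℕ) ≠ i := fun h' => h (Fin.ext h')
    by_cases h1 : (l : ℕ) + 1 = i
    · have : (l : ℕ) ≠ i + 1 := by omega
      simp [stringFactor, h, h', h1, this]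
    · simp [stringFactor, h, h', h1]

/-- Without neighbouring centres, `X` and `Z` never meet at a site, so no sign or phase arises; only
two `Z` factors can meet. -/
lemma stringFactor_insert {E : Finset ℕ} {i : ℕ} (hi : i ∉ E)
    (hE : ∀ e ∈ E, e ≠ i + 1 ∧ i ≠ e + 1) (l : ℕ) :
    stringFactor (insert i E) l = stringFactor E l * stringFactor {i} l := by
  by_cases hl : l = i
  · subst hl
    have h1 : l + 1 ∉ E := fun h => (hE _ h).1 rfl
    have h2 : ¬ ∃ e ∈ E, l = e + 1 := fun ⟨e, he, h⟩ => (hE e he).2 h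
    simp only [stringFactor, Finset.mem_insert_self, Finset.mem_singleton, if_true, if_neg h1,
      if_neg h2, if_neg hi, one_mul]
  by_cases hlE : l ∈ E
  · have h1 : l + 1 ≠ i := fun h => (hE _ hlE).2 h.symm
    have h2 : l ≠ i + 1 := (hE _ hlE).1
    simp [stringFactor, hlE, hl, h1, h2]
  by_cases h1 : l + 1 = i
  · have h2 : l ≠ i + 1 := by omega
    have h3 : l + 1 ∉ E := h1 ▸ hi
    subst h1
    by_cases h4 : ∃ e ∈ E, l = e + 1 <;>
      simp [stringFactor, hlE, hi, h2, h4, pauliZ_mul_self]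
  by_cases h2 : l = i + 1
  · subst h2
    by_cases h4 : i + 1 + 1 ∈ E <;>
      simp [stringFactor, hlE, hi, h1, h4]
  simp [stringFactor, hl, hlE, h1, h2]

/-- Union bound for the product of the generators centred in `E`. -/
lemma IsState.one_sub_card_mul_le_expVal {N : ℕ} {ρ : Op (Fin N)} (hρ : IsState ρ) {a : ℝ}
    (E : Finset ℕ) (hind : ∀ e ∈ E, ∀ f ∈ E, e ≠ f + 1)
    (hE : ∀ e ∈ E, ∃ i : Fin N, (i : ℕ) = e ∧ a ≤ expVal ρ (generator i)) :
    1 - (E.card : ℝ) * (1 - a) ≤ expVal ρ (tensorOp fun l : Fin N => stringFactor E l) := by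
  induction E using Finset.induction_on with
  | empty => simp [stringFactor_empty, tensorOp_one, hρ.expVal_one]
  | insert i E hi ih =>
    have ih := ih (fun e he f hf => hind e (by simp [he]) f (by simp [hf]))
      (fun e he => hE e (by simp [he]))
    obtain ⟨i', rfl, hi'⟩ := hE i (by simp)
    have hmul : tensorOp (fun l : Fin N => stringFactor (insert (i' : ℕ) E) l)
        = tensorOp (fun l : Fin N => stringFactor E l) * generator i' := by
      rw [← stringFactor_singleton, tensorOp_mul]
      congr 1
      funext l
      exact stringFactor_insert hi
        (fun e he => ⟨hind e (by simp [he]) _ (by simp), hind _ (by simp) e (by simp [he])⟩) l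
    have hH : ∀ E : Finset ℕ, (tensorOp fun l : Fin N => stringFactor E l).IsHermitian :=
      fun E => tensorOp_isHermitian fun l => stringFactor_isHermitian E l
    have h1 : ∀ E : Finset ℕ, (tensorOp fun l : Fin N => stringFactor E l) *
        (tensorOp fun l : Fin N => stringFactor E l) = 1 := fun E => by
      rw [tensorOp_mul]
      simp only [stringFactor_mul_self, tensorOp_one]
    -- The product is again a string, hence Hermitian, which encodes that the factors commute.
    have h := hρ.expVal_add_expVal_sub_one_le_expVal_mul (hH E) (hH {(i' : ℕ)})
      (by rw [stringFactor_singleton, ← hmul]; exact hH _) (h1 E) (h1 {(i' : ℕ)})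
    rw [stringFactor_singleton, ← hmul] at h
    rw [Finset.card_insert_of_notMem hi]
    push_cast
    linarith

/-! ### The measurement bases -/

/-- The eigenbasis of `pauliX`. -/
noncomputable def hadamard : Matrix.unitaryGroup (Fin 2) ℂ :=
  ⟨((Real.sqrt 2 : ℝ) : ℂ)⁻¹ • !![1, 1; 1, -1], by
    have h : ((Real.sqrt 2 : ℝ) : ℂ)⁻¹ * ((Real.sqrt 2 : ℝ) : ℂ)⁻¹ = 2⁻¹ := by
      rw [← mul_inv, ← Complex.ofReal_mul, Real.mul_self_sqrt zero_le_two]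
      simp
    rw [Matrix.mem_unitaryGroup_iff, Matrix.star_eq_conjTranspose]
    ext x y
    fin_cases x <;> fin_cases y <;>
      simp [Matrix.mul_apply, Fin.sum_univ_two, h] <;> norm_num⟩

lemma actsBySigns_one (U : Matrix.unitaryGroup (Fin 2) ℂ) : ActsBySigns 1 U :=
  ⟨fun _ => 1, fun _ => Or.inl rfl, fun s => by simp⟩

lemma actsBySigns_pauliZ : ActsBySigns pauliZ 1 := by
  refine ⟨fun s => if s = 0 then 1 else -1, fun s => by dsimp only; split_ifs <;> simp, fun s => ?_⟩
  ext x y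
  fin_cases s <;> fin_cases x <;> fin_cases y <;>
    simp [pauliZ, basisProj, Matrix.vecMulVec_apply, Matrix.mul_apply, Fin.sum_univ_two]

lemma actsBySigns_pauliX : ActsBySigns pauliX hadamard := by
  refine ⟨fun s => if s = 0 then 1 else -1, fun s => by dsimp only; split_ifs <;> simp, fun s => ?_⟩
  ext x y
  fin_cases s <;> fin_cases x <;> fin_cases y <;>
    simp only [basisProj, Matrix.smul_apply, Matrix.mul_apply, Matrix.vecMulVec_apply,
      Fin.sum_univ_two] <;>
    simp [pauliX, hadamard]

/-! ### Localizable entanglement -/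

/-- The sites from `j` to `l` of parity `r` relative to `j`. -/
def paritySites (j l r : ℕ) : Finset ℕ := (Finset.Icc j l).filter fun e => (e + j) % 2 = r

lemma mem_paritySites {j l r e : ℕ} :
    e ∈ paritySites j l r ↔ (j ≤ e ∧ e ≤ l) ∧ (e + j) % 2 = r := by
  simp [paritySites]

lemma card_paritySites_add {j l k : ℕ} (hl : l = j + k) :
    (paritySites j l 0).card + (paritySites j l 1).card = k + 1 := by
  have h : paritySites j l 1 = (Finset.Icc j l).filter fun e => ¬ (e + j) % 2 = 0 :=
    Finset.filter_congr fun e _ => by omega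
  rw [h, paritySites, Finset.card_filter_add_card_filter_not, Nat.card_Icc]
  omega

/-- Strictly between the targets, both neighbours of `q` have the same parity and lie in range, so
the `Z` factors come in pairs. Outside there is no `X`, and the computational basis diagonalizes
what remains. -/
lemma actsBySigns_stringFactor {j l r : ℕ} (q : ℕ) (hqj : q ≠ j) (hql : q ≠ l) :
    ActsBySigns (stringFactor (paritySites j l r) q) (if j < q ∧ q < l then hadamard else 1) := by
  have hex : (∃ e ∈ paritySites j l r, q = e + 1) ↔ 1 ≤ q ∧ q - 1 ∈ paritySites j l r :=
    ⟨fun ⟨e, he, h⟩ => by subst h; simpa using he, fun ⟨h1, h⟩ => ⟨q - 1, h, by omega⟩⟩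
  by_cases hq : j < q ∧ q < l
  · rw [if_pos hq]
    by_cases hm : q ∈ paritySites j l r
    · rw [stringFactor, if_pos hm]
      exact actsBySigns_pauliX
    · have h : q + 1 ∈ paritySites j l r ↔ 1 ≤ q ∧ q - 1 ∈ paritySites j l r := by
        have hpar : (q + 1 + j) % 2 = (q - 1 + j) % 2 := by omega
        rw [mem_paritySites, mem_paritySites, hpar]
        constructor
        · rintro ⟨-, h⟩
          exact ⟨by omega, by omega, h⟩
        · rintro ⟨-, -, h⟩
          exact ⟨by omega, h⟩
      rw [stringFactor, if_neg hm]
      -- Both conditions become the same one, leaving only `Z * Z` and `1 * 1`.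
      simp only [hex, ← h]
      split_ifs
      · rw [pauliZ_mul_self]; exact actsBySigns_one _
      · rw [one_mul]; exact actsBySigns_one _
  · have hm : q ∉ paritySites j l r := fun h => by
      have h := (mem_paritySites.1 h).1
      clear hex
      omega
    rw [if_neg hq, stringFactor, if_neg hm]
    split_ifs <;>
      simp only [pauliZ_mul_self, one_mul, mul_one, actsBySigns_one, actsBySigns_pauliZ]

/-- The string with `r = 0` has `X` at `j` and the other has `Z` there; the parity of `k` decides
which of them has `X` at `l`. -/
lemma bellPair_stringFactor {j l k : ℕ} (hk : 1 ≤ k) (hl : l = j + k) :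
    BellPair (stringFactor (paritySites j l 0) j ⊗ₖ
        stringFactor (paritySites j l 0) l)
      (stringFactor (paritySites j l 1) j ⊗ₖ
        stringFactor (paritySites j l 1) l) := by
  have hX : ∀ {r q : ℕ}, q ∈ paritySites j l r →
      stringFactor (paritySites j l r) q = pauliX := fun h => by
    rw [stringFactor, if_pos h]
  have h0 : stringFactor (paritySites j l 0) j = pauliX :=
    hX (by rw [mem_paritySites]; omega)
  have h1 : stringFactor (paritySites j l 1) j = pauliZ := by
    rw [stringFactor, if_neg (by rw [mem_paritySites]; omega),
      if_pos (by rw [mem_paritySites]; omega), if_neg, mul_one]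
    rintro ⟨e, he, h⟩
    rw [mem_paritySites] at he
    omega
  have hZ : ∀ {r : ℕ}, l ∉ paritySites j l r → l - 1 ∈ paritySites j l r →
      stringFactor (paritySites j l r) l = pauliZ := fun h h' => by
    rw [stringFactor, if_neg h, if_neg (by rw [mem_paritySites]; omega),
      if_pos ⟨_, h', by omega⟩, one_mul]
  rw [h0, h1]
  rcases Nat.mod_two_eq_zero_or_one k with hk2 | hk2
  · rw [hX (r := 0) (by rw [mem_paritySites]; omega),
      hZ (r := 1) (by rw [mem_paritySites]; omega) (by rw [mem_paritySites]; omega)]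
    exact bellPair_ZZ_XX.symm
  · rw [hZ (r := 0) (by rw [mem_paritySites]; omega) (by rw [mem_paritySites]; omega),
      hX (r := 1) (by rw [mem_paritySites]; omega)]
    exact bellPair_XZ_ZX

/-- Bounds on the generators centred between `j` and `l` give a bound on the localizable
entanglement of `j` and `l`. -/
theorem max_zero_le_localizableEntanglement {a : ℝ} {N : ℕ} {ρ : Op (Fin N)} (hρ : IsState ρ)
    {j l : Fin N} {k : ℕ} (hk : 1 ≤ k) (hl : (l : ℕ) = j + k)
    (ha : ∀ i : Fin N, j ≤ i → i ≤ l → a ≤ expVal ρ (generator i)) :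
    max 0 (1 - ((k : ℝ) + 1) * (1 - a)) ≤ localizableEntanglement ρ j l := by
  have hjl : j ≠ l := fun h => by rw [h] at hl; omega
  refine max_le (localizableEntanglement_nonneg hjl hρ) ?_
  have hS : ∀ r, 1 - ((paritySites j l r).card : ℝ) * (1 - a) ≤
      expVal ρ (tensorOp fun q : Fin N => stringFactor (paritySites j l r) q) := fun r => by
    refine hρ.one_sub_card_mul_le_expVal _ (fun e he f hf => ?_) fun e he => ?_
    · rw [mem_paritySites] at he hf
      omega
    · rw [mem_paritySites] at he
      exact ⟨⟨e, by omega⟩, rfl, ha _ he.1.1 he.1.2⟩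
  -- The same bases must serve both strings; this choice does not depend on the parity class.
  let m : MeasurementBases j l := fun q =>
    if (j : ℕ) < (q : Fin N) ∧ ((q : Fin N) : ℕ) < l then hadamard else 1
  have hm : ∀ r, ∀ q : Others j l,
      ActsBySigns (stringFactor (paritySites j l r) (q : Fin N)) (m q) := fun r q =>
    actsBySigns_stringFactor _ (fun h => q.2.1 (Fin.ext h))
      (fun h => q.2.2 (Fin.ext h))
  have hB := bellPair_stringFactor hk hl
  have h := expVal_add_expVal_sub_one_le
    (F := fun q : Fin N => stringFactor (paritySites j l 0) q)
    (G := fun q : Fin N => stringFactor (paritySites j l 1) q) hjl hρ (hm 0) (hm 1) hB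
  have hc : ((paritySites j l 0).card : ℝ) + (paritySites j l 1).card = k + 1 := by
    exact_mod_cast card_paritySites_add hl
  have h2 := averageConcurrence_le_localizableEntanglement hjl hρ m
  have h3 : 1 - ((k : ℝ) + 1) * (1 - a) = (1 - ((paritySites j l 0).card : ℝ) * (1 - a)) +
      (1 - ((paritySites j l 1).card : ℝ) * (1 - a)) - 1 := by
    rw [← hc]
    ring
  linarith [hS 0, hS 1]

end LinearCluster

theorem mainTheorem1 (a : ℝ) :
    -- Chain with all its generators, including those at the two ends: any pair of qubits.
    (∀ (N : ℕ) (ρ : LinearCluster.Op (Fin N)), LinearCluster.IsState ρ →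
      (∀ i : Fin N, a ≤ LinearCluster.expVal ρ (LinearCluster.generator i)) →
      ∀ (j l : Fin N) (k : ℕ), 1 ≤ k → (l : ℕ) = j + k →
        max 0 (1 - ((k : ℝ) + 1) * (1 - a)) ≤ LinearCluster.localizableEntanglement ρ j l) ∧
    -- Chain with generators on three neighbouring qubits only: any pair of qubits in the bulk.
    (∀ (N : ℕ) (ρ : LinearCluster.Op (Fin N)), LinearCluster.IsState ρ →
      (∀ i : Fin N, 0 < (i : ℕ) → (i : ℕ) + 1 < N →
        a ≤ LinearCluster.expVal ρ (LinearCluster.generator i)) →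
      ∀ (j l : Fin N) (k : ℕ), 1 ≤ k → (l : ℕ) = j + k → 0 < (j : ℕ) → (l : ℕ) + 1 < N →
        max 0 (1 - ((k : ℝ) + 1) * (1 - a)) ≤ LinearCluster.localizableEntanglement ρ j l) ∧
    -- The end qubits of a segment of `n` qubits with boundary generators `XZ` and `ZX`.
    (∀ (n : ℕ) (hn : 2 ≤ n) (ρ : LinearCluster.Op (Fin n)), LinearCluster.IsState ρ →
      (∀ i : Fin n, a ≤ LinearCluster.expVal ρ (LinearCluster.generator i)) →
        max 0 (1 - (n : ℝ) * (1 - a)) ≤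
          LinearCluster.localizableEntanglement ρ ⟨0, by omega⟩ ⟨n - 1, by omega⟩) ∧
    -- The threshold `2/3` for entanglement across one qubit, in the same three situations.
    (2 / 3 < a →
      (∀ (N : ℕ) (ρ : LinearCluster.Op (Fin N)), LinearCluster.IsState ρ →
        (∀ i : Fin N, a ≤ LinearCluster.expVal ρ (LinearCluster.generator i)) →
        ∀ j l : Fin N, (l : ℕ) = j + 2 →
          0 < LinearCluster.localizableEntanglement ρ j l) ∧
      (∀ (N : ℕ) (ρ : LinearCluster.Op (Fin N)), LinearCluster.IsState ρ →
        (∀ i : Fin N, 0 < (i : ℕ) → (i : ℕ) + 1 < N →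
          a ≤ LinearCluster.expVal ρ (LinearCluster.generator i)) →
        ∀ j l : Fin N, (l : ℕ) = j + 2 → 0 < (j : ℕ) → (l : ℕ) + 1 < N →
          0 < LinearCluster.localizableEntanglement ρ j l) ∧
      (∀ ρ : LinearCluster.Op (Fin 3), LinearCluster.IsState ρ →
        (∀ i : Fin 3, a ≤ LinearCluster.expVal ρ (LinearCluster.generator i)) →
          0 < LinearCluster.localizableEntanglement ρ 0 2)) := by
  have bulk : ∀ (N : ℕ) (ρ : LinearCluster.Op (Fin N)), LinearCluster.IsState ρ →
      (∀ i : Fin N, 0 < (i : ℕ) → (i : ℕ) + 1 < N →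
        a ≤ LinearCluster.expVal ρ (LinearCluster.generator i)) →
      ∀ (j l : Fin N) (k : ℕ), 1 ≤ k → (l : ℕ) = j + k → 0 < (j : ℕ) → (l : ℕ) + 1 < N →
        max 0 (1 - ((k : ℝ) + 1) * (1 - a)) ≤ LinearCluster.localizableEntanglement ρ j l :=
    fun N ρ hρ ha j l k hk hl hj hlN =>
      LinearCluster.max_zero_le_localizableEntanglement hρ hk hl fun i hji hil =>
        ha i (hj.trans_le hji) (by have : (i : ℕ) ≤ l := hil; omega)
  -- At distance `2` three generators enter, and `1 - 3 * (1 - a)` is positive exactly when `a > 2 /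
  -- 3`.
  have threshold : 2 / 3 < a → 0 < max (0 : ℝ) (1 - (((2 : ℕ) : ℝ) + 1) * (1 - a)) := fun ha =>
    lt_max_of_lt_right (by push_cast; linarith)
  refine ⟨fun N ρ hρ ha j l k hk hl =>
      LinearCluster.max_zero_le_localizableEntanglement hρ hk hl fun i _ _ => ha i,
    bulk, fun n hn ρ hρ ha => ?_, fun ha => ⟨fun N ρ hρ hK j l hl => ?_,
      fun N ρ hρ hK j l hl hj hlN => ?_, fun ρ hρ hK => ?_⟩⟩
  -- The end qubits are at distance `n - 1`, so `k + 1` becomes `n`.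
  · have h := LinearCluster.max_zero_le_localizableEntanglement (k := n - 1) hρ
      (j := ⟨0, by omega⟩) (l := ⟨n - 1, by omega⟩) (by omega) (by simp) fun i _ _ => ha i
    rwa [Nat.cast_sub (by omega : 1 ≤ n), Nat.cast_one, sub_add_cancel] at h
  · exact (threshold ha).trans_le
      (LinearCluster.max_zero_le_localizableEntanglement hρ one_le_two hl fun i _ _ => hK i)
  · exact (threshold ha).trans_le (bulk N ρ hρ hK j l 2 one_le_two hl hj hlN)
  · exact (threshold ha).trans_le
      (LinearCluster.max_zero_le_localizableEntanglement hρ one_le_two rfl fun i _ _ => hK i)
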